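/- Let $E$ be a (real) Banach lattice, let $E'$ be its norm dual, ordered by $f\le g$ iff $f(x)\le g(x)$ for all $x\ge 0$ in $E$, and let $\ell_1$ carry its usual norm and the coordinatewise order. Then the following assertions are equivalent: (1) Each positive (continuous linear) operator $T:E\to\ell_1$ is uaw-Dunford–Pettis, that is, $\|Tx_n\|\to 0$ for every norm bounded sequence $(x_n)$ in $E$ such that $x_n\xrightarrow{uaw}0$, where $x_n\xrightarrow{uaw}0$ means that $|x_n|\wedge u\to 0$ weakly in $E$ for every $u\in E_+$. (2) The norm of $E'$ is order continuous, that is, for each net $(f_\alpha)$ in $E'$ with $f_\alpha\downarrow 0$ (decreasing with infimum $0$), one has $\|f_\alpha\|\to 0$. -/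

import Mathlib

open Filter Topology

namespace BanachLattice

universe u v

/-- The order of the norm dual `E'`: `f ≤ g` means `f x ≤ g x` for every `x ≥ 0` in `E`.
(If `E` is a Banach lattice, then `E'` is a Banach lattice for this order and the operator norm.) -/
instance dualPartialOrder {E : Type u} [NormedAddCommGroup E] [NormedSpace ℝ E] [Lattice E]
    [IsOrderedAddMonoid E] : PartialOrder (StrongDual ℝ E) where
  le f g := ∀ x : E, 0 ≤ x → f x ≤ g x
  le_refl _ _ _ := le_rfl
  le_trans _ _ _ hfg hgh x hx := (hfg x hx).trans (hgh x hx)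
  le_antisymm f g hfg hgf := by
    ext x
    have hp := le_antisymm (hfg _ (posPart_nonneg x)) (hgf _ (posPart_nonneg x))
    have hn := le_antisymm (hfg _ (negPart_nonneg x)) (hgf _ (negPart_nonneg x))
    rw [← posPart_sub_negPart x, map_sub, map_sub, hp, hn]

/-- The Banach space `ℓ¹` of real sequences `a` with `‖a‖ = ∑ₙ |aₙ| < ∞`. -/
abbrev EllOne : Type := lp (fun _ : ℕ => ℝ) 1

/-- The order of `ℓ¹` is the coordinatewise one. -/
instance ellOnePartialOrder : PartialOrder EllOne where
  le a b := ∀ n : ℕ, a n ≤ b n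
  le_refl _ _ := le_rfl
  le_trans _ _ _ hab hbc n := (hab n).trans (hbc n)
  le_antisymm _ _ hab hba := lp.ext (funext fun n => le_antisymm (hab n) (hba n))

/-- The norm of `X` is order continuous: every net `x` with `x_α ↓ 0` (decreasing with infimum `0`)
satisfies `‖x_α‖ → 0`. Index sets in the universe of `X` suffice, since the range of a decreasing
net is itself a net with the reversed order of `X`. -/
def HasOrderContinuousNorm (X : Type u) [NormedAddCommGroup X] [PartialOrder X] : Prop :=
  ∀ (ι : Type u) [Preorder ι] [IsDirectedOrder ι] [Nonempty ι] (x : ι → X),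
    Antitone x → IsGLB (Set.range x) 0 → Tendsto (fun α => ‖x α‖) atTop (𝓝 0)

/-- Unbounded absolute weak convergence of `x` to `a` along a filter: `|x_i - a| ⊓ u → 0` in the
weak topology of `E`, for every `u ≥ 0`. -/
def UawTendsto {E : Type u} [NormedAddCommGroup E] [NormedSpace ℝ E] [Lattice E]
    {ι : Type v} (x : ι → E) (l : Filter ι) (a : E) : Prop :=
  ∀ u : E, 0 ≤ u →
    Tendsto (fun i => toWeakSpace ℝ E (|x i - a| ⊓ u)) l (𝓝 (toWeakSpace ℝ E 0))

/-- `T` is unbounded absolute weak Dunford-Pettis: it maps norm bounded uaw-null sequences to norm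
null sequences. -/
def IsUawDunfordPettis {E : Type u} [NormedAddCommGroup E] [NormedSpace ℝ E] [Lattice E]
    {X : Type v} [NormedAddCommGroup X] [NormedSpace ℝ X] (T : E →L[ℝ] X) : Prop :=
  ∀ x : ℕ → E, (∃ C : ℝ, ∀ n, ‖x n‖ ≤ C) → UawTendsto x atTop 0 →
    Tendsto (fun n => ‖T (x n)‖) atTop (𝓝 0)

/-- `T` is a positive operator. -/
def IsPositiveOperator {E : Type u} [NormedAddCommGroup E] [NormedSpace ℝ E] [PartialOrder E]
    {F : Type v} [NormedAddCommGroup F] [NormedSpace ℝ F] [PartialOrder F] (T : E →L[ℝ] F) :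
    Prop :=
  ∀ x : E, 0 ≤ x → 0 ≤ T x

end BanachLattice

namespace BanachLattice

/-! Both assertions reduce to positive functionals. Composing a positive `T` with the sum functional
on `ℓ¹` gives `f ≥ 0` with `‖T x‖ ≤ f |x|`; conversely, every `f ≥ 0` yields the positive rank one
operator `f ⊗ e₀`.

(2) ⇒ (1): split `f |xₙ| = f (|xₙ| ⊓ u) + f ((|xₙ| - u)⁺)`. Uaw convergence handles the first term;
`exists_apply_posPart_sub_le` chooses `u` making the second uniformly small on a ball. If no such
`u` existed, components of `f` in suitable bands would decrease to `0` without tending to `0` in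
norm.

(1) ⇒ (2): disjoint positive sequences are uaw-null, so every `f ≥ 0` tends to `0` along the norm
bounded ones. A net `f_α ↓ 0` with norms bounded away from `0` would allow a disjoint bounded
sequence to be extracted on which a single `f_α` stays large
(`hasOrderContinuousNorm_dual_of_disjoint`). -/

theorem smul_inf_of_pos {E : Type*} [AddCommGroup E] [Lattice E] [Module ℝ E]
    [IsOrderedModule ℝ E] {c : ℝ} (hc : 0 < c) (a b : E) : c • (a ⊓ b) = c • a ⊓ c • b :=
  (OrderIso.smulRight hc).map_inf a b

theorem smul_posPart_of_pos {E : Type*} [AddCommGroup E] [Lattice E] [Module ℝ E]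
    [IsOrderedModule ℝ E] {c : ℝ} (hc : 0 < c) (a : E) : c • a⁺ = (c • a)⁺ := by
  have h : c • (a ⊔ 0) = c • a ⊔ c • 0 := (OrderIso.smulRight hc).map_sup a 0
  rwa [smul_zero] at h

theorem norm_mono_of_nonneg {E : Type*} [NormedAddCommGroup E] [Lattice E] [IsOrderedAddMonoid E]
    [HasSolidNorm E] {x y : E} (hx : 0 ≤ x) (h : x ≤ y) : ‖x‖ ≤ ‖y‖ := by
  refine norm_le_norm_of_abs_le_abs ?_
  rwa [abs_of_nonneg hx, abs_of_nonneg (hx.trans h)]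

/-! ### Lattice inequalities and disjointness. -/

section VectorLattice

variable {E : Type*} [AddCommGroup E] [Lattice E] [IsOrderedAddMonoid E]

theorem add_inf_le_inf_add_inf {x y a : E} (hx : 0 ≤ x) (hy : 0 ≤ y) (ha : 0 ≤ a) :
    (x + y) ⊓ a ≤ x ⊓ a + y ⊓ a := by
  simp only [add_inf, inf_add, le_inf_iff]
  refine ⟨⟨inf_le_left, inf_le_right.trans (le_add_of_nonneg_right hy)⟩,
    inf_le_right.trans (le_add_of_nonneg_left hx), inf_le_right.trans (le_add_of_nonneg_left ha)⟩

theorem inf_add_le_inf_add_inf {x a b : E} (hx : 0 ≤ x) (ha : 0 ≤ a) (hb : 0 ≤ b) :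
    x ⊓ (a + b) ≤ x ⊓ a + x ⊓ b := by
  simpa only [inf_comm x] using add_inf_le_inf_add_inf ha hb hx

theorem inf_add_inf_le_add_inf_add (x y a b : E) : x ⊓ a + y ⊓ b ≤ (x + y) ⊓ (a + b) :=
  le_inf (add_le_add inf_le_left inf_le_left) (add_le_add inf_le_right inf_le_right)

theorem inf_add_posPart_sub (x a : E) : x ⊓ a + (x - a)⁺ = x := by
  rw [inf_eq_sub_posPart_sub, sub_add_cancel]

/-- A finite sum of pairwise disjoint positive elements bounded by `u` is bounded by `u`. -/
theorem sum_le_of_pairwise_disjoint {y : ℕ → E} {u : E} (hu : 0 ≤ u) (hy : ∀ n, 0 ≤ y n)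
    (hyu : ∀ n, y n ≤ u) (hd : ∀ m n, m < n → y m ⊓ y n = 0) (s : Finset ℕ) :
    ∑ i ∈ s, y i ≤ u := by
  classical
  have hinf : ∀ (s : Finset ℕ) (n : ℕ), n ∉ s → (∑ i ∈ s, y i) ⊓ y n = 0 := by
    intro s n
    induction s using Finset.induction_on with
    | empty => intro _; simpa using hy n
    | insert m s hm ih =>
      intro hn
      rw [Finset.mem_insert, not_or] at hn
      have hmn : y m ⊓ y n = 0 := by
        rcases lt_or_gt_of_ne hn.1 with h | h
        · rw [inf_comm]; exact hd _ _ h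
        · exact hd _ _ h
      rw [Finset.sum_insert hm]
      refine le_antisymm ?_ (le_inf (add_nonneg (hy m) (Finset.sum_nonneg fun i _ => hy i)) (hy n))
      refine (add_inf_le_inf_add_inf (hy m) (Finset.sum_nonneg fun i _ => hy i) (hy n)).trans ?_
      rw [hmn, ih hn.2, add_zero]
  induction s using Finset.induction_on with
  | empty => simpa using hu
  | insert m s hm ih =>
    rw [Finset.sum_insert hm, add_comm, ← inf_add_sup, hinf s m hm, zero_add]
    exact sup_le ih (hyu m)

variable [Module ℝ E] [IsOrderedModule ℝ E]

theorem inf_smul_eq_zero {a b : E} (ha : 0 ≤ a) (hb : 0 ≤ b) (h : a ⊓ b = 0) {c : ℝ}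
    (hc : 0 ≤ c) : a ⊓ c • b = 0 := by
  refine le_antisymm ?_ (le_inf ha (smul_nonneg hc hb))
  have hc' : 0 < 1 + c := by linarith
  calc a ⊓ c • b ≤ (1 + c) • a ⊓ (1 + c) • b := by
        rw [add_smul, add_smul, one_smul, one_smul]
        exact inf_le_inf (le_add_of_nonneg_right (smul_nonneg hc ha)) (le_add_of_nonneg_left hb)
    _ = 0 := by rw [← smul_inf_of_pos hc', h, smul_zero]

/-- Left side minus `a` is at most both `(u - a)⁺` and `j • (a - u)⁺`, which are disjoint. The bound
does not depend on `j`. -/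
theorem inf_nsmul_posPart_sub_le {a u : E} (ha : 0 ≤ a) (j : ℕ) : u ⊓ j • (a - u)⁺ ≤ a := by
  rw [← Nat.cast_smul_eq_nsmul ℝ]
  have hdis : (u - a)⁺ ⊓ (j : ℝ) • (a - u)⁺ = 0 := by
    refine inf_smul_eq_zero (posPart_nonneg _) (posPart_nonneg _) ?_ j.cast_nonneg
    rw [← neg_sub u a, posPart_neg]
    exact posPart_inf_negPart_eq_zero _
  have hj : 0 ≤ (j : ℝ) • (a - u)⁺ := smul_nonneg j.cast_nonneg (posPart_nonneg _)
  rw [← sub_nonpos, ← hdis]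
  refine le_inf ((sub_le_sub_right inf_le_left _).trans (le_posPart _)) ?_
  exact (sub_le_self _ ha).trans inf_le_right

/-- Since `c * d ≥ 1`, `c • (b - d • a)⁺` lies below `(a - c • b)⁻`, which is disjoint from `(a - c
• b)⁺`. -/
theorem posPart_sub_smul_inf_posPart_sub_smul {a b : E} (ha : 0 ≤ a) {c d : ℝ}
    (hc : 0 < c) (hcd : 1 ≤ c * d) : (a - c • b)⁺ ⊓ (b - d • a)⁺ = 0 := by
  have hle : c • (b - d • a)⁺ ≤ (a - c • b)⁻ := by
    rw [smul_posPart_of_pos hc, ← posPart_neg, neg_sub]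
    refine posPart_mono ?_
    rw [smul_sub, smul_smul]
    refine sub_le_sub_left ?_ _
    simpa using smul_le_smul_of_nonneg_right hcd ha
  have hzero : (a - c • b)⁺ ⊓ c • (b - d • a)⁺ = 0 := by
    refine le_antisymm ?_ (le_inf (posPart_nonneg _) (smul_nonneg hc.le (posPart_nonneg _)))
    rw [← posPart_inf_negPart_eq_zero (a - c • b)]
    exact inf_le_inf_left _ hle
  have := inf_smul_eq_zero (posPart_nonneg _) (smul_nonneg hc.le (posPart_nonneg _)) hzero
    (inv_nonneg.2 hc.le)
  rwa [inv_smul_smul₀ hc.ne'] at this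

end VectorLattice

/-! ### Positive functionals, their components and monotone limits. -/

section Dual

variable {E : Type*} [NormedAddCommGroup E] [NormedSpace ℝ E] [Lattice E]
  [IsOrderedAddMonoid E]

theorem map_mono_of_nonneg {f : StrongDual ℝ E} (hf : 0 ≤ f) {x y : E} (h : x ≤ y) :
    f x ≤ f y := by
  have : 0 ≤ f (y - x) := hf _ (sub_nonneg.2 h)
  rw [map_sub] at this
  linarith

theorem abs_apply_le_apply_abs {f : StrongDual ℝ E} (hf : 0 ≤ f) (x : E) : |f x| ≤ f |x| := by
  refine abs_le'.2 ⟨map_mono_of_nonneg hf (le_abs_self x), ?_⟩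
  rw [← map_neg]
  exact map_mono_of_nonneg hf (neg_le_abs x)

theorem isGLB_range_zero_of_tendsto {ι : Type*} [Preorder ι] [IsDirectedOrder ι] [Nonempty ι]
    {f : ι → StrongDual ℝ E} (hf : Antitone f)
    (h : ∀ x, 0 ≤ x → Tendsto (fun i => f i x) atTop (𝓝 0)) : IsGLB (Set.range f) 0 := by
  refine ⟨?_, fun g hg x hx => ?_⟩
  · rintro _ ⟨i, rfl⟩ x hx
    exact le_of_tendsto (h x hx) (Filter.eventually_atTop.2 ⟨i, fun j hij => hf hij x hx⟩)
  · exact ge_of_tendsto' (h x hx) fun i => hg ⟨i, rfl⟩ x hx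

variable [HasSolidNorm E]

theorem dual_norm_le_of_nonneg_of_le {f g : StrongDual ℝ E} (hf : 0 ≤ f) (h : f ≤ g) :
    ‖f‖ ≤ ‖g‖ := by
  refine f.opNorm_le_bound (norm_nonneg g) fun x => ?_
  calc ‖f x‖ ≤ f |x| := abs_apply_le_apply_abs hf x
    _ ≤ g |x| := h _ (abs_nonneg x)
    _ ≤ ‖g‖ * ‖|x|‖ := (le_abs_self _).trans (g.le_opNorm _)
    _ = ‖g‖ * ‖x‖ := by rw [norm_abs_eq_norm]

/-- A bounded positive additive function on the positive cone extends to a continuous linear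
functional. -/
theorem exists_dual_of_additive {p : E → ℝ} {C : ℝ}
    (hadd : ∀ x y, 0 ≤ x → 0 ≤ y → p (x + y) = p x + p y) (hnonneg : ∀ x, 0 ≤ x → 0 ≤ p x)
    (hbound : ∀ x, 0 ≤ x → p x ≤ C * ‖x‖) :
    ∃ g : StrongDual ℝ E, ∀ x, 0 ≤ x → g x = p x := by
  have hzero : p 0 = 0 := by
    have := hadd 0 0 le_rfl le_rfl
    rw [add_zero] at this
    linarith
  -- The value is the same for every decomposition into a difference of positive elements; this
  -- gives additivity of the extension.
  have hrep : ∀ a b x : E, 0 ≤ a → 0 ≤ b → x = a - b → p x⁺ - p x⁻ = p a - p b := by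
    intro a b x ha hb hx
    have h : x⁺ + b = a + x⁻ := by
      have := posPart_sub_negPart x
      rw [hx] at this ⊢
      rw [sub_eq_sub_iff_add_eq_add] at this
      exact this
    have h' := congrArg p h
    rw [hadd _ _ (posPart_nonneg x) hb, hadd _ _ ha (negPart_nonneg x)] at h'
    linarith
  let F : E →+ ℝ :=
    { toFun := fun x => p x⁺ - p x⁻
      map_zero' := by simp
      map_add' := fun x y => by
        have := hrep (x⁺ + y⁺) (x⁻ + y⁻) (x + y)
          (add_nonneg (posPart_nonneg x) (posPart_nonneg y))
          (add_nonneg (negPart_nonneg x) (negPart_nonneg y))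
          (by rw [add_sub_add_comm, posPart_sub_negPart, posPart_sub_negPart])
        rw [this, hadd _ _ (posPart_nonneg x) (posPart_nonneg y),
          hadd _ _ (negPart_nonneg x) (negPart_nonneg y)]
        ring }
  have hF : ∀ x, ‖F x‖ ≤ C * ‖x‖ := fun x => by
    have h1 := hnonneg _ (posPart_nonneg x)
    have h2 := hnonneg _ (negPart_nonneg x)
    calc ‖F x‖ = |p x⁺ - p x⁻| := rfl
      _ ≤ p x⁺ + p x⁻ := abs_le.2 ⟨by linarith, by linarith⟩
      _ = p |x| := by
        rw [← hadd _ _ (posPart_nonneg x) (negPart_nonneg x), posPart_add_negPart]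
      _ ≤ C * ‖|x|‖ := hbound _ (abs_nonneg x)
      _ = C * ‖x‖ := by rw [norm_abs_eq_norm]
  refine ⟨F.toRealLinearMap (AddMonoidHomClass.continuous_of_bound F C hF), fun x hx => ?_⟩
  change p x⁺ - p x⁻ = p x
  rw [posPart_of_nonneg hx, negPart_of_nonneg hx, hzero, sub_zero]

/-- The component of a positive functional `f` in the band generated by `u`: on positive elements it
is the limit of `f (x ⊓ n • u)`. -/
theorem exists_component {f : StrongDual ℝ E} (hf : 0 ≤ f) {u : E} (hu : 0 ≤ u) :
    ∃ g : StrongDual ℝ E, ∀ x, 0 ≤ x →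
      Tendsto (fun n : ℕ => f (x ⊓ n • u)) atTop (𝓝 (g x)) := by
  have hlim : ∀ x, 0 ≤ x →
      Tendsto (fun n : ℕ => f (x ⊓ n • u)) atTop (𝓝 (⨆ n : ℕ, f (x ⊓ n • u))) := fun x _ =>
    tendsto_atTop_ciSup
      (fun m n h => map_mono_of_nonneg hf (inf_le_inf_left _ (nsmul_le_nsmul_left hu h)))
      ⟨f x, by rintro _ ⟨n, rfl⟩; exact map_mono_of_nonneg hf inf_le_left⟩
  suffices h : ∃ g : StrongDual ℝ E, ∀ x, 0 ≤ x → g x = ⨆ n : ℕ, f (x ⊓ n • u) by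
    obtain ⟨g, hg⟩ := h
    exact ⟨g, fun x hx => by rw [hg x hx]; exact hlim x hx⟩
  refine exists_dual_of_additive (C := ‖f‖) (fun x y hx hy => ?_) (fun x hx => ?_)
    (fun x hx => ?_)
  · refine le_antisymm ?_ ?_
    · refine le_of_tendsto_of_tendsto' (hlim _ (add_nonneg hx hy)) ((hlim x hx).add (hlim y hy))
        fun n => ?_
      rw [← map_add]
      exact map_mono_of_nonneg hf (add_inf_le_inf_add_inf hx hy (nsmul_nonneg hu n))
    -- Superadditivity costs a doubling of the index: `x ⊓ n • u + y ⊓ n • u ≤ (x + y) ⊓ 2n • u`.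
    · have hdouble : Tendsto (fun n : ℕ => n + n) atTop atTop :=
        tendsto_atTop_mono (fun n => Nat.le_add_left n n) tendsto_id
      refine le_of_tendsto_of_tendsto' ((hlim x hx).add (hlim y hy))
        ((hlim _ (add_nonneg hx hy)).comp hdouble) fun n => ?_
      rw [← map_add, Function.comp_apply, add_nsmul]
      exact map_mono_of_nonneg hf (inf_add_inf_le_add_inf_add _ _ _ _)
  · exact ge_of_tendsto' (hlim x hx) fun n => hf _ (le_inf hx (nsmul_nonneg hu n))
  · exact le_of_tendsto' (hlim x hx) fun n =>
      (map_mono_of_nonneg hf inf_le_left).trans ((le_abs_self _).trans (f.le_opNorm x))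

/-- The pointwise infimum of a decreasing net of positive functionals is additive on the cone, so it
extends to a lower bound in the dual and must vanish. -/
theorem tendsto_apply_of_isGLB {ι : Type*} [Preorder ι] [IsDirectedOrder ι] [Nonempty ι]
    {f : ι → StrongDual ℝ E} (hf : Antitone f) (h : IsGLB (Set.range f) 0) {x : E} (hx : 0 ≤ x) :
    Tendsto (fun i => f i x) atTop (𝓝 0) := by
  have hnonneg : ∀ i, 0 ≤ f i := fun i => h.1 ⟨i, rfl⟩
  have hlim : ∀ x, 0 ≤ x → Tendsto (fun i => f i x) atTop (𝓝 (⨅ i, f i x)) := fun x hx =>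
    tendsto_atTop_ciInf (fun i j hij => hf hij x hx)
      ⟨0, by rintro _ ⟨i, rfl⟩; exact hnonneg i x hx⟩
  obtain ⟨i₀⟩ := ‹Nonempty ι›
  obtain ⟨g, hg⟩ := exists_dual_of_additive (p := fun x => ⨅ i, f i x) (C := ‖f i₀‖)
    (fun x y hx hy => tendsto_nhds_unique (hlim _ (add_nonneg hx hy))
      (by simpa only [map_add] using (hlim x hx).add (hlim y hy)))
    (fun x hx => ge_of_tendsto' (hlim x hx) fun i => hnonneg i x hx)
    (fun x hx => (ciInf_le ⟨0, by rintro _ ⟨i, rfl⟩; exact hnonneg i x hx⟩ i₀).trans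
      ((le_abs_self _).trans ((f i₀).le_opNorm x)))
  have hg0 : g ≤ 0 := h.2 (by
    rintro _ ⟨i, rfl⟩ x hx
    rw [hg x hx]
    exact ciInf_le ⟨0, by rintro _ ⟨i, rfl⟩; exact hnonneg i x hx⟩ i)
  have hle : (⨅ i, f i x) ≤ 0 := by rw [← hg x hx]; exact hg0 x hx
  have hge : 0 ≤ ⨅ i, f i x := ge_of_tendsto' (hlim x hx) fun i => hnonneg i x hx
  have := hlim x hx
  rwa [le_antisymm hle hge] at this

end Dual
-- Sequential and weak-topology reformulations.
theorem HasOrderContinuousNorm.tendsto_of_seq {X : Type*} [NormedAddCommGroup X] [PartialOrder X]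
    (h : HasOrderContinuousNorm X) {x : ℕ → X} (hx : Antitone x) (hglb : IsGLB (Set.range x) 0) :
    Tendsto (fun n => ‖x n‖) atTop (𝓝 0) := by
  have hnet := h (ULift ℕ) (fun n => x n.down) (fun m n hmn => hx hmn) (by
    have : Set.range (fun n : ULift ℕ => x n.down) = Set.range x :=
      ULift.down_surjective.range_comp x
    rwa [this])
  have hup : Tendsto (ULift.up : ℕ → ULift ℕ) atTop atTop :=
    tendsto_atTop_atTop.2 fun b => ⟨b.down, fun a ha => ha⟩
  exact hnet.comp hup

theorem uawTendsto_zero_iff {E : Type*} [NormedAddCommGroup E] [NormedSpace ℝ E] [Lattice E]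
    {ι : Type*} {x : ι → E} {l : Filter ι} :
    UawTendsto x l 0 ↔
      ∀ u, 0 ≤ u → ∀ f : StrongDual ℝ E, Tendsto (fun i => f (|x i| ⊓ u)) l (𝓝 0) := by
  have hind : IsInducing fun (x : WeakSpace ℝ E) (f : StrongDual ℝ E) =>
      (topDualPairing ℝ E).flip x f := ⟨rfl⟩
  refine forall₂_congr fun u _ => ?_
  rw [hind.tendsto_nhds_iff, tendsto_pi_nhds]
  refine forall_congr' fun f => ?_
  change Tendsto (fun i => f (|x i - 0| ⊓ u)) l (𝓝 (f 0)) ↔ _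
  rw [map_zero]
  simp only [sub_zero]

theorem summable_geometric_smul {E : Type*} [NormedAddCommGroup E] [NormedSpace ℝ E]
    [CompleteSpace E] {x : ℕ → E} {M : ℝ} (hx : ∀ n, ‖x n‖ ≤ M) :
    Summable fun n => ((1 : ℝ) / 2) ^ n • x n := by
  refine Summable.of_norm_bounded (g := fun n => (1 / 2 : ℝ) ^ n * M)
    (summable_geometric_two.mul_right M) fun n => ?_
  rw [norm_smul, norm_pow, Real.norm_of_nonneg (by norm_num : (0 : ℝ) ≤ 1 / 2)]
  gcongr
  exact hx n

/-! ### Order continuity of the dual norm gives uniform smallness on balls. -/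

section

variable {E : Type*} [NormedAddCommGroup E] [NormedSpace ℝ E] [Lattice E]
  [IsOrderedAddMonoid E] [HasSolidNorm E]

/-- A positive functional has, up to a small error in norm, a component that is carried by a single
positive element. -/
theorem exists_norm_sub_component_le (hoc : HasOrderContinuousNorm (StrongDual ℝ E))
    {f : StrongDual ℝ E} (hf : 0 ≤ f) {ε : ℝ} (hε : 0 < ε) :
    ∃ u : E, 0 ≤ u ∧ ∃ g : StrongDual ℝ E, 0 ≤ g ∧ ‖f - g‖ ≤ ε ∧
      ∀ x, 0 ≤ x → Tendsto (fun n : ℕ => g ((x - n • u)⁺)) atTop (𝓝 0) := by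
  -- The components of `f`, indexed by the directed positive cone, increase to `f` pointwise, since
  -- `g u` agrees with `f` on `[0, u]`.
  choose g hg using fun u : {u : E // 0 ≤ u} => exists_component hf u.2
  have hmono : Monotone g := fun u v huv x hx =>
    le_of_tendsto_of_tendsto' (hg u x hx) (hg v x hx) fun n =>
      map_mono_of_nonneg hf (inf_le_inf_left _ (nsmul_le_nsmul_right huv n))
  have hnonneg : ∀ u, 0 ≤ g u := fun u x hx =>
    ge_of_tendsto' (hg u x hx) fun n => hf _ (le_inf hx (nsmul_nonneg u.2 n))
  have heq : ∀ (u : {u : E // 0 ≤ u}) (x : E), 0 ≤ x → ∀ n : ℕ, x ≤ n • u.1 → g u x = f x := by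
    intro u x hx n hn
    refine tendsto_nhds_unique (hg u x hx) (tendsto_atTop_of_eventually_const (i₀ := n) ?_)
    intro m hm
    rw [inf_eq_left.2 (hn.trans (nsmul_le_nsmul_left u.2 hm))]
  have hdir : IsDirectedOrder {u : E // 0 ≤ u} :=
    ⟨fun u v => ⟨⟨u.1 + v.1, add_nonneg u.2 v.2⟩, le_add_of_nonneg_right v.2,
      le_add_of_nonneg_left u.2⟩⟩
  have : Nonempty {u : E // 0 ≤ u} := ⟨⟨0, le_rfl⟩⟩
  have hanti : Antitone fun u => f - g u := fun u v huv x hx => by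
    have := hmono huv x hx
    simp only [_root_.sub_apply]
    linarith
  have hpt : ∀ x, 0 ≤ x → Tendsto (fun u => (f - g u) x) atTop (𝓝 0) := by
    intro x hx
    refine tendsto_const_nhds.congr' ?_
    filter_upwards [eventually_ge_atTop (⟨x, hx⟩ : {u : E // 0 ≤ u})] with u hu
    have hxu : x ≤ u.1 := hu
    rw [_root_.sub_apply, heq u x hx 1 (by rwa [one_nsmul]), sub_self]
  have hlim := hoc {u : E // 0 ≤ u} (fun u => f - g u) hanti (isGLB_range_zero_of_tendsto hanti hpt)
  obtain ⟨u, hu⟩ := (hlim.eventually_lt_const hε).exists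
  refine ⟨u, u.2, g u, hnonneg u, hu.le, fun x hx => ?_⟩
  have h0 : Tendsto (fun n : ℕ => g u x - f (x ⊓ n • u.1)) atTop (𝓝 0) := by
    simpa using (hg u x hx).const_sub (g u x)
  refine h0.congr fun n => ?_
  rw [← heq u _ (le_inf hx (nsmul_nonneg u.2 n)) n inf_le_right, ← map_sub, sub_eq_iff_eq_add'.2]
  rw [inf_add_posPart_sub]

end

section

variable {E : Type*} [NormedAddCommGroup E] [NormedSpace ℝ E] [CompleteSpace E] [Lattice E]
  [IsOrderedAddMonoid E] [IsOrderedModule ℝ E] [HasSolidNorm E]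

/-- If the norm of the dual is order continuous, a positive functional is uniformly small on the
positive parts `(x - u)⁺`, `x` in a bounded set, for a suitable `u`. -/
theorem exists_apply_posPart_sub_le (hoc : HasOrderContinuousNorm (StrongDual ℝ E))
    {f : StrongDual ℝ E} (hf : 0 ≤ f) (M : ℝ) {ε : ℝ} (hε : 0 < ε) :
    ∃ u : E, 0 ≤ u ∧ ∀ x, 0 ≤ x → ‖x‖ ≤ M → f ((x - u)⁺) ≤ ε := by
  by_contra! hcon
  have hM : 0 < |M| + 1 := by positivity
  obtain ⟨u, hu, F, hF, hnorm, hcarrier⟩ :=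
    exists_norm_sub_component_le hoc hf (ε := ε / 2 / (|M| + 1)) (by positivity)
  -- The factor `2 ^ n` makes `2⁻ⁿ • zₙ` equal to `(2⁻ⁿ • xₙ - u)⁺`, whose multiples meet `u` below
  -- the small element `2⁻ⁿ • xₙ`.
  choose x hx0 hxM hx using fun n : ℕ => hcon ((2 : ℝ) ^ n • u) (smul_nonneg (by positivity) hu)
  have hxM' : ∀ n, ‖x n‖ ≤ |M| + 1 := fun n => (hxM n).trans (by linarith [le_abs_self M])
  set z : ℕ → E := fun n => (x n - (2 : ℝ) ^ n • u)⁺ with hz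
  have hz0 : ∀ n, 0 ≤ z n := fun n => posPart_nonneg _
  have hzM : ∀ n, ‖z n‖ ≤ |M| + 1 := fun n =>
    (norm_mono_of_nonneg (hz0 n) (by
      exact sup_le (sub_le_self _ (smul_nonneg (by positivity) hu)) (hx0 n))).trans (hxM' n)
  have hFz : ∀ n, ε / 2 ≤ F (z n) := by
    intro n
    have h1 : (f - F) (z n) ≤ ε / 2 := by
      calc (f - F) (z n) ≤ ‖f - F‖ * ‖z n‖ := (le_abs_self _).trans ((f - F).le_opNorm _)
        _ ≤ ε / 2 / (|M| + 1) * (|M| + 1) := by gcongr; exact hzM n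
        _ = ε / 2 := by field_simp
    have h2 := hx n
    rw [_root_.sub_apply] at h1
    change ε < f (z n) at h2
    linarith
  -- the tails of the series `∑ 2⁻ⁿ zₙ`
  set y : ℕ → E := fun n => ((1 : ℝ) / 2) ^ n • z n with hy
  have hy0 : ∀ n, 0 ≤ y n := fun n => smul_nonneg (by positivity) (hz0 n)
  have hsum : Summable y := summable_geometric_smul hzM
  set w : ℕ → E := fun n => ∑' k, y k - ∑ k ∈ Finset.range n, y k with hw
  have hw0 : ∀ n, 0 ≤ w n := fun n => sub_nonneg.2 (hsum.sum_le_tsum _ fun k _ => hy0 k)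
  have hwsucc : ∀ n, w n = y n + w (n + 1) := fun n => by
    simp only [hw, Finset.sum_range_succ]; abel
  have hwanti : Antitone w := antitone_nat_of_succ_le fun n => by
    rw [hwsucc n]; exact le_add_of_nonneg_left (hy0 n)
  have hwlim : Tendsto w atTop (𝓝 0) := by
    simpa [hw] using hsum.hasSum.tendsto_sum_nat.const_sub (∑' k, y k)
  have hyeq : ∀ n, y n = (((1 : ℝ) / 2) ^ n • x n - u)⁺ := fun n => by
    have h2 : ((1 : ℝ) / 2) ^ n * 2 ^ n = 1 := by rw [← mul_pow]; norm_num
    simp only [hy, hz]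
    rw [smul_posPart_of_pos (by positivity), smul_sub, smul_smul, h2, one_smul]
  set K : ℝ := ‖F‖ * (|M| + 1) with hK
  have hinf : ∀ n j : ℕ, F (u ⊓ j • w n) ≤ (1 / 2) ^ n * (2 * K) := by
    intro n j
    have hstep : ∀ n, F (u ⊓ j • w n) ≤ (1 / 2) ^ n * K + F (u ⊓ j • w (n + 1)) := by
      intro n
      have hFx : F (((1 : ℝ) / 2) ^ n • x n) ≤ (1 / 2) ^ n * K := by
        rw [map_smul, smul_eq_mul]
        gcongr
        exact (le_abs_self _).trans ((F.le_opNorm _).trans (by rw [hK]; gcongr; exact hxM' n))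
      have h1 : u ⊓ j • w n ≤ ((1 : ℝ) / 2) ^ n • x n + u ⊓ j • w (n + 1) := by
        rw [hwsucc n, nsmul_add]
        refine (inf_add_le_inf_add_inf hu (nsmul_nonneg (hy0 n) j)
          (nsmul_nonneg (hw0 _) j)).trans (add_le_add_left ?_ _)
        rw [hyeq n]
        exact inf_nsmul_posPart_sub_le (smul_nonneg (by positivity) (hx0 n)) j
      have h2 := map_mono_of_nonneg hF h1
      rw [map_add] at h2
      linarith
    -- `hstep` telescopes, and `2 * K` comes from `∑ 2⁻ᵏ = 2`: the difference increases to `0`,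
    -- hence is nonpositive.
    have hmono : Monotone fun n => F (u ⊓ j • w n) - (1 / 2) ^ n * (2 * K) :=
      monotone_nat_of_le_succ fun n => by
        have := hstep n
        have h3 : ((1 : ℝ) / 2) ^ (n + 1) * (2 * K) = (1 / 2) ^ n * K := by rw [pow_succ]; ring
        have h4 : ((1 : ℝ) / 2) ^ n * (2 * K) = 2 * ((1 / 2) ^ n * K) := by ring
        rw [h3, h4]
        linarith
    have hlim : Tendsto (fun n => F (u ⊓ j • w n) - (1 / 2) ^ n * (2 * K)) atTop (𝓝 0) := by
      have h1 : Tendsto (fun n => F (u ⊓ j • w n)) atTop (𝓝 0) := by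
        have hub : Tendsto (fun n => F (j • w n)) atTop (𝓝 0) := by
          simpa using ((F.continuous.tendsto _).comp hwlim).const_mul (j : ℝ)
        exact squeeze_zero (fun n => hF _ (le_inf hu (nsmul_nonneg (hw0 n) j)))
          (fun n => map_mono_of_nonneg hF inf_le_right) hub
      have h2 : Tendsto (fun n : ℕ => ((1 : ℝ) / 2) ^ n * (2 * K)) atTop (𝓝 0) := by
        simpa using (tendsto_pow_atTop_nhds_zero_of_lt_one (by norm_num : (0 : ℝ) ≤ 1 / 2)
          (by norm_num)).mul_const (2 * K)
      simpa using h1.sub h2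
    have := hmono.ge_of_tendsto hlim n
    linarith
  -- `H n` is the component of `F` carried by the tail `w n`. It decreases to `0`, yet agrees with
  -- `F` at `z n ≤ 2 ^ n • w n`, so its norm stays bounded below.
  choose H hH using fun n => exists_component hF (hw0 n)
  have hHanti : Antitone H := fun m n hmn x hx =>
    le_of_tendsto_of_tendsto' (hH n x hx) (hH m x hx) fun k =>
      map_mono_of_nonneg hF (inf_le_inf_left _ (nsmul_le_nsmul_right (hwanti hmn) k))
  have hH0 : ∀ n, 0 ≤ H n := fun n x hx =>
    ge_of_tendsto' (hH n x hx) fun k => hF _ (le_inf hx (nsmul_nonneg (hw0 n) k))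
  have hHF : ∀ n, H n ≤ F := fun n x hx =>
    le_of_tendsto' (hH n x hx) fun k => map_mono_of_nonneg hF inf_le_left
  have hHu : Tendsto (fun n => H n u) atTop (𝓝 0) := by
    refine squeeze_zero (fun n => hH0 n u hu)
      (fun n => le_of_tendsto' (hH n u hu) fun j => hinf n j) ?_
    simpa using (tendsto_pow_atTop_nhds_zero_of_lt_one (by norm_num : (0 : ℝ) ≤ 1 / 2)
      (by norm_num)).mul_const (2 * K)
  have hHz : ∀ n, H n (z n) = F (z n) := by
    intro n
    have hzw : z n ≤ (2 ^ n) • w n := by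
      have h1 : (2 ^ n) • y n ≤ (2 ^ n) • w n :=
        nsmul_le_nsmul_right (by rw [hwsucc n]; exact le_add_of_nonneg_right (hw0 _)) _
      refine le_trans (le_of_eq ?_) h1
      have h2 : (2 : ℝ) ^ n * (1 / 2) ^ n = 1 := by rw [← mul_pow]; norm_num
      rw [← Nat.cast_smul_eq_nsmul ℝ]
      simp only [hy]
      rw [smul_smul]
      push_cast
      rw [h2, one_smul]
    refine tendsto_nhds_unique (hH n _ (hz0 n))
      (tendsto_atTop_of_eventually_const (i₀ := 2 ^ n) fun m hm => ?_)
    rw [inf_eq_left.2 (hzw.trans (nsmul_le_nsmul_left (hw0 n) hm))]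
  -- As `F` is carried by `u` and `H n ≤ F`, convergence at `u` forces convergence everywhere on the
  -- cone.
  have hHpt : ∀ v, 0 ≤ v → Tendsto (fun n => H n v) atTop (𝓝 0) := by
    intro v hv
    refine Metric.tendsto_atTop'.2 fun δ hδ => ?_
    obtain ⟨j, hj⟩ := ((hcarrier v hv).eventually_lt_const (half_pos hδ)).exists
    have hju : Tendsto (fun n => (j : ℝ) * H n u) atTop (𝓝 0) := by
      simpa using hHu.const_mul (j : ℝ)
    obtain ⟨N, hN⟩ := eventually_atTop.1 (hju.eventually_lt_const (half_pos hδ))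
    refine ⟨N, fun n hn => ?_⟩
    rw [Real.dist_eq, sub_zero, abs_of_nonneg (hH0 n v hv)]
    have h1 : H n (v ⊓ j • u) ≤ (j : ℝ) * H n u :=
      (map_mono_of_nonneg (hH0 n) inf_le_right).trans_eq (by rw [map_nsmul, nsmul_eq_mul])
    have h2 := hHF n _ (posPart_nonneg (v - j • u))
    have h3 := hN n hn.le
    rw [← inf_add_posPart_sub v (j • u), map_add]
    linarith
  have hHnorm := hoc.tendsto_of_seq hHanti (isGLB_range_zero_of_tendsto hHanti hHpt)
  have hlow : ∀ n, ε / 2 ≤ ‖H n‖ * (|M| + 1) := fun n =>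
    calc ε / 2 ≤ H n (z n) := by rw [hHz n]; exact hFz n
      _ ≤ ‖H n‖ * ‖z n‖ := (le_abs_self _).trans ((H n).le_opNorm _)
      _ ≤ ‖H n‖ * (|M| + 1) := by gcongr; exact hzM n
  have := ge_of_tendsto' (hHnorm.mul_const (|M| + 1)) hlow
  rw [zero_mul] at this
  linarith

end

/-! ### Uaw-null sequences, disjoint sequences and the dual norm. -/

section

variable {E : Type*} [NormedAddCommGroup E] [NormedSpace ℝ E] [Lattice E]
  [IsOrderedAddMonoid E] [HasSolidNorm E]

/-- Disjoint sequences of positive elements are uaw-null. -/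
theorem uawTendsto_zero_of_disjoint {z : ℕ → E} (hz : ∀ n, 0 ≤ z n)
    (hd : ∀ m n, m < n → z m ⊓ z n = 0) : UawTendsto z atTop 0 := by
  refine uawTendsto_zero_iff.2 fun u hu f => ?_
  set y : ℕ → E := fun n => z n ⊓ u with hy
  have hy0 : ∀ n, 0 ≤ y n := fun n => le_inf (hz n) hu
  have hyd : ∀ m n, m < n → y m ⊓ y n = 0 := fun m n h =>
    le_antisymm ((inf_le_inf inf_le_left inf_le_left).trans_eq (hd m n h))
      (le_inf (hy0 m) (hy0 n))
  have hbound : ∀ s : Finset ℕ, ∑ i ∈ s, |f (y i)| ≤ ‖f‖ * ‖u‖ := by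
    intro s
    have hle := sum_le_of_pairwise_disjoint hu hy0 (fun n => inf_le_right) hyd s
    -- The signs turn `∑ |f (y i)|` into the value of `f` at one element of `[-u, u]`, so the series
    -- converges.
    set v : E := ∑ i ∈ s, (SignType.sign (f (y i)) : ℝ) • y i with hv
    have hsigned : ∀ i, |(SignType.sign (f (y i)) : ℝ) • y i| ≤ y i := fun i => by
      rcases SignType.trichotomy (SignType.sign (f (y i))) with h | h | h <;>
        simp [h, abs_of_nonneg (hy0 i), hy0 i]
    have hvu : |v| ≤ u := by
      refine abs_le'.2 ⟨?_, ?_⟩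
      · exact (Finset.sum_le_sum fun i _ => (le_abs_self _).trans (hsigned i)).trans hle
      · rw [hv, ← Finset.sum_neg_distrib]
        exact (Finset.sum_le_sum fun i _ => (neg_le_abs _).trans (hsigned i)).trans hle
    have hfv : f v = ∑ i ∈ s, |f (y i)| := by
      rw [hv, map_sum]
      refine Finset.sum_congr rfl fun i _ => ?_
      rw [map_smul, smul_eq_mul, sign_mul_self]
    calc ∑ i ∈ s, |f (y i)| = f v := hfv.symm
      _ ≤ ‖f‖ * ‖v‖ := (le_abs_self _).trans (f.le_opNorm v)
      _ ≤ ‖f‖ * ‖u‖ := by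
        gcongr
        exact norm_le_norm_of_abs_le_abs (hvu.trans (le_abs_self u))
  have hsum : Summable fun i => |f (y i)| := summable_of_sum_le (fun i => abs_nonneg _) hbound
  have := (tendsto_zero_iff_abs_tendsto_zero _).2 hsum.tendsto_atTop_zero
  refine this.congr fun n => ?_
  rw [abs_of_nonneg (hz n)]

theorem tendsto_apply_abs_of_uawTendsto [CompleteSpace E] [IsOrderedModule ℝ E]
    (hoc : HasOrderContinuousNorm (StrongDual ℝ E)) {f : StrongDual ℝ E} (hf : 0 ≤ f)
    {x : ℕ → E} {C : ℝ} (hC : ∀ n, ‖x n‖ ≤ C) (hx : UawTendsto x atTop 0) :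
    Tendsto (fun n => f |x n|) atTop (𝓝 0) := by
  refine Metric.tendsto_atTop'.2 fun ε hε => ?_
  obtain ⟨u, hu, hfu⟩ := exists_apply_posPart_sub_le hoc hf C (half_pos hε)
  obtain ⟨N, hN⟩ := eventually_atTop.1
    ((uawTendsto_zero_iff.1 hx u hu f).eventually_lt_const (half_pos hε))
  refine ⟨N, fun n hn => ?_⟩
  rw [Real.dist_eq, sub_zero, abs_of_nonneg (hf _ (abs_nonneg _)),
    ← inf_add_posPart_sub |x n| u, map_add]
  have h1 := hN n hn.le
  have h2 := hfu |x n| (abs_nonneg _) (by rw [norm_abs_eq_norm]; exact hC n)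
  linarith

theorem exists_apply_lt_of_lt_dual_norm {f : StrongDual ℝ E} (hf : 0 ≤ f) {ε : ℝ} (hε : 0 ≤ ε)
    (h : ε < ‖f‖) : ∃ x, 0 ≤ x ∧ ‖x‖ ≤ 1 ∧ ε < f x := by
  by_contra! hcon
  refine h.not_ge (f.opNorm_le_of_unit_norm hε fun x hx => ?_)
  exact (abs_apply_le_apply_abs hf x).trans
    (hcon _ (abs_nonneg x) (by rw [norm_abs_eq_norm, hx]))

/-- If positive functionals tend to zero along every norm bounded disjoint sequence of positive
elements, then the norm of the dual is order continuous. -/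
theorem hasOrderContinuousNorm_dual_of_disjoint [CompleteSpace E] [IsOrderedModule ℝ E]
    (h : ∀ f : StrongDual ℝ E, 0 ≤ f → ∀ z : ℕ → E, (∀ n, 0 ≤ z n) → (∀ n, ‖z n‖ ≤ 1) →
      (∀ m n, m < n → z m ⊓ z n = 0) → Tendsto (fun n => f (z n)) atTop (𝓝 0)) :
    HasOrderContinuousNorm (StrongDual ℝ E) := by
  intro ι _ _ _ f hanti hglb
  have hf0 : ∀ i, 0 ≤ f i := fun i => hglb.1 ⟨i, rfl⟩
  by_contra hnot
  obtain ⟨ε, hε, hlow⟩ : ∃ ε > 0, ∀ i, ε < ‖f i‖ := by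
    by_contra! hcon
    refine hnot (Metric.tendsto_nhds.2 fun δ hδ => ?_)
    obtain ⟨i, hi⟩ := hcon (δ / 2) (half_pos hδ)
    filter_upwards [eventually_ge_atTop i] with j hj
    rw [Real.dist_eq, sub_zero, abs_of_nonneg (norm_nonneg _)]
    have := dual_norm_le_of_nonneg_of_le (hf0 j) (hanti hj)
    linarith
  choose x hx0 hx1 hx using fun i => exists_apply_lt_of_lt_dual_norm (hf0 i) hε.le (hlow i)
  obtain ⟨i₀⟩ := ‹Nonempty ι›
  have hstep : ∀ (n : ℕ) (s : {s : E // 0 ≤ s}), ∃ i, i₀ ≤ i ∧ f i ((4 : ℝ) ^ n • s.1) < ε / 2 := by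
    intro n s
    have : Nonempty ι := ⟨i₀⟩
    have hlim := tendsto_apply_of_isGLB hanti hglb
      (smul_nonneg (by positivity : (0 : ℝ) ≤ 4 ^ n) s.2)
    exact ((eventually_ge_atTop i₀).and (hlim.eventually_lt_const (half_pos hε))).exists
  choose A hA0 hA using hstep
  -- `S n` is the sum of the vectors already chosen; the next functional is nearly zero on `4 ^ n •
  -- S n` but exceeds `ε` at the next vector.
  let S : ℕ → {s : E // 0 ≤ s} := fun n =>
    Nat.rec ⟨0, le_rfl⟩ (fun n s => ⟨s.1 + x (A n s), add_nonneg s.2 (hx0 _)⟩) n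
  set y : ℕ → E := fun n => x (A n (S n)) with hy
  have hS : ∀ n, (S (n + 1)).1 = (S n).1 + y n := fun n => rfl
  have hSmono : Monotone fun n => (S n).1 := monotone_nat_of_le_succ fun n => by
    rw [hS]; exact le_add_of_nonneg_right (hx0 _)
  have hyS : ∀ m n, m < n → y m ≤ (S n).1 := fun m n hmn =>
    (by rw [hS]; exact le_add_of_nonneg_left (S m).2 : y m ≤ (S (m + 1)).1).trans (hSmono hmn)
  have hsum : Summable fun n => ((1 : ℝ) / 2) ^ n • y n := summable_geometric_smul fun n => hx1 _
  have hterm : ∀ n, 0 ≤ ((1 : ℝ) / 2) ^ n • y n := fun n => smul_nonneg (by positivity) (hx0 _)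
  set w : E := ∑' n, ((1 : ℝ) / 2) ^ n • y n with hw
  have hw0 : 0 ≤ w := tsum_nonneg hterm
  have hyw : ∀ n, ((1 : ℝ) / 2) ^ n • y n ≤ w := fun n => by
    simpa only [Finset.sum_singleton] using hsum.sum_le_tsum {n} fun k _ => hterm k
  -- Subtracting `4 ^ n • S n` separates `y n` from earlier vectors, subtracting `2⁻ⁿ • w` from
  -- later ones; `4 ^ n` outweighs `2⁻ᵐ * 2⁻ⁿ` for `m < n`.
  set r : ℕ → E := fun n => y n - (4 : ℝ) ^ n • (S n).1 - ((1 : ℝ) / 2) ^ n • w with hr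
  have hS0 : ∀ n, 0 ≤ (4 : ℝ) ^ n • (S n).1 := fun n => smul_nonneg (by positivity) (S n).2
  have hw0' : ∀ n, 0 ≤ ((1 : ℝ) / 2) ^ n • w := fun n => smul_nonneg (by positivity) hw0
  have hd : ∀ m n, m < n → (r m)⁺ ⊓ (r n)⁺ = 0 := by
    intro m n hmn
    have h1 : (r m)⁺ ≤ (y m - (((1 : ℝ) / 2) ^ m * (1 / 2) ^ n) • y n)⁺ := by
      refine posPart_mono ?_
      rw [mul_smul]
      exact sub_le_sub (sub_le_self _ (hS0 m)) (smul_le_smul_of_nonneg_left (hyw n) (by positivity))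
    have h2 : (r n)⁺ ≤ (y n - (4 : ℝ) ^ n • y m)⁺ := by
      refine posPart_mono ((sub_le_self _ (hw0' n)).trans (sub_le_sub_left ?_ _))
      exact smul_le_smul_of_nonneg_left (hyS m n hmn) (by positivity)
    have hcd : (1 : ℝ) ≤ (1 / 2) ^ m * (1 / 2) ^ n * 4 ^ n := by
      have h3 : ((1 : ℝ) / 2) ^ n ≤ (1 / 2) ^ m :=
        pow_le_pow_of_le_one (by norm_num) (by norm_num) hmn.le
      calc (1 : ℝ) = (1 / 2) ^ n * (1 / 2) ^ n * 4 ^ n := by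
            rw [← mul_pow, ← mul_pow]; norm_num
        _ ≤ _ := by gcongr
    refine le_antisymm ((inf_le_inf h1 h2).trans_eq ?_)
      (le_inf (posPart_nonneg _) (posPart_nonneg _))
    exact posPart_sub_smul_inf_posPart_sub_smul (hx0 _) (by positivity) hcd
  have hr1 : ∀ n, ‖(r n)⁺‖ ≤ 1 := fun n =>
    (norm_mono_of_nonneg (posPart_nonneg _)
      (sup_le ((sub_le_self _ (hw0' n)).trans (sub_le_self _ (hS0 n))) (hx0 _))).trans (hx1 _)
  have hlim := h (f i₀) (hf0 i₀) (fun n => (r n)⁺) (fun n => posPart_nonneg _) hr1 hd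
  have hle : ∀ n, ε / 2 ≤ f i₀ (r n)⁺ + (1 / 2) ^ n * f i₀ w := by
    intro n
    set i := A n (S n)
    have h1 : ε < f i (y n) := hx i
    have h2 : f i ((4 : ℝ) ^ n • (S n).1) < ε / 2 := hA n (S n)
    have h3 : f i (((1 : ℝ) / 2) ^ n • w) ≤ (1 / 2) ^ n * f i₀ w := by
      rw [← smul_eq_mul, ← map_smul]
      exact hanti (hA0 n (S n)) _ (hw0' n)
    have h4 : f i (r n) ≤ f i₀ (r n)⁺ :=
      (map_mono_of_nonneg (hf0 i) (le_posPart _)).trans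
        (hanti (hA0 n (S n)) _ (posPart_nonneg _))
    simp only [hr, map_sub] at h4
    linarith
  have hfin := ge_of_tendsto' (hlim.add ((tendsto_pow_atTop_nhds_zero_of_lt_one
    (by norm_num : (0 : ℝ) ≤ 1 / 2) (by norm_num)).mul_const (f i₀ w))) hle
  rw [zero_mul, add_zero] at hfin
  linarith

end

/-! ### Positive operators into `ℓ¹` versus positive functionals. -/

theorem summable_ellOne (a : EllOne) : Summable fun n => ‖a n‖ := by
  simpa using (lp.memℓp a).summable (by simp)

theorem norm_ellOne_eq_tsum (a : EllOne) : ‖a‖ = ∑' n, ‖a n‖ := by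
  simpa using lp.norm_eq_tsum_rpow (p := 1) (by simp) a

/-- A positive operator into `ℓ¹` is dominated in norm by a positive functional. -/
theorem IsPositiveOperator.exists_norm_le_apply_abs {E : Type*} [NormedAddCommGroup E]
    [NormedSpace ℝ E] [Lattice E] [IsOrderedAddMonoid E] {T : E →L[ℝ] EllOne}
    (hT : IsPositiveOperator T) : ∃ f : StrongDual ℝ E, 0 ≤ f ∧ ∀ x, ‖T x‖ ≤ f |x| := by
  have hsum : ∀ a : EllOne, Summable fun n => a n := fun a => (summable_ellOne a).of_norm
  let σ : EllOne →ₗ[ℝ] ℝ :=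
    { toFun := fun a => ∑' n, a n
      map_add' := fun a b => by simpa using (hsum a).tsum_add (hsum b)
      map_smul' := fun c a => by simpa using tsum_mul_left }
  let f : StrongDual ℝ E := (σ.mkContinuous 1 fun a => by
    rw [one_mul, norm_ellOne_eq_tsum]
    exact norm_tsum_le_tsum_norm (summable_ellOne a)).comp T
  refine ⟨f, fun x hx => tsum_nonneg (hT x hx), fun x => ?_⟩
  rw [norm_ellOne_eq_tsum]
  refine (summable_ellOne _).tsum_le_tsum (fun n => ?_) (hsum _)
  have h1 : 0 ≤ T (|x| - x) n := hT _ (sub_nonneg.2 (le_abs_self x)) n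
  have h2 : 0 ≤ T (|x| + x) n := hT _ (by
    rw [← sub_neg_eq_add]; exact sub_nonneg.2 (neg_le_abs x)) n
  rw [map_sub, lp.coeFn_sub, Pi.sub_apply] at h1
  rw [map_add, lp.coeFn_add, Pi.add_apply] at h2
  change |T x n| ≤ T |x| n
  exact abs_le.2 ⟨by linarith, by linarith⟩

theorem tendsto_apply_of_forall_isUawDunfordPettis {E : Type*} [NormedAddCommGroup E]
    [NormedSpace ℝ E] [Lattice E] [IsOrderedAddMonoid E]
    (h : ∀ T : E →L[ℝ] EllOne, IsPositiveOperator T → IsUawDunfordPettis T)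
    {f : StrongDual ℝ E} (hf : 0 ≤ f) {x : ℕ → E} {C : ℝ} (hC : ∀ n, ‖x n‖ ≤ C)
    (hx : UawTendsto x atTop 0) : Tendsto (fun n => f (x n)) atTop (𝓝 0) := by
  let e : EllOne := lp.single (E := fun _ : ℕ => ℝ) 1 0 (1 : ℝ)
  have he : 0 ≤ e := fun n => by
    change (0 : ℝ) ≤ lp.single (E := fun _ : ℕ => ℝ) 1 0 (1 : ℝ) n
    by_cases hn : n = 0
    · subst hn; simp
    · simp [hn]
  have he1 : ‖e‖ = 1 := by simp [e, lp.norm_single]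
  have hpos : IsPositiveOperator (f.smulRight e) := fun x hx n =>
    mul_nonneg (hf x hx) (he n)
  have := h _ hpos x ⟨C, hC⟩ hx
  simpa [norm_smul, he1, tendsto_zero_iff_abs_tendsto_zero, Function.comp_def] using this

end BanachLattice

theorem theorem3p3 {E : Type*} [NormedAddCommGroup E] [NormedSpace ℝ E] [CompleteSpace E]
    [Lattice E] [IsOrderedAddMonoid E] [IsOrderedModule ℝ E] [HasSolidNorm E] :
    (∀ T : E →L[ℝ] BanachLattice.EllOne,
        BanachLattice.IsPositiveOperator T → BanachLattice.IsUawDunfordPettis T) ↔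
      BanachLattice.HasOrderContinuousNorm (StrongDual ℝ E) := by
  refine ⟨fun h => ?_, fun hoc T hT x hC hx => ?_⟩
  · refine BanachLattice.hasOrderContinuousNorm_dual_of_disjoint fun f hf z hz hz1 hd => ?_
    exact BanachLattice.tendsto_apply_of_forall_isUawDunfordPettis h hf hz1
      (BanachLattice.uawTendsto_zero_of_disjoint hz hd)
  · obtain ⟨C, hC⟩ := hC
    obtain ⟨f, hf, hTf⟩ := hT.exists_norm_le_apply_abs
    exact squeeze_zero (fun n => norm_nonneg _) (fun n => hTf (x n))
      (BanachLattice.tendsto_apply_abs_of_uawTendsto hoc hf hC hx)
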